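/- Let $k,p\ge1$ be integers. For $w\in\mathbb R^p$ let $\|w\|_0$ be the number of nonzero entries of $w$, let $\mathcal A_k^p=\{a\in\mathbb R^p:\|a\|_0\le k,\ \|a\|_2=1\}$, and let $\theta_k(x)=\inf\{t>0: x\in t\,\mathrm{conv}(\mathcal A_k^p)\}$ be the $k$-support norm. For a norm $\Omega$ on $\mathbb R^p$, the tangent cone of $\Omega$ at $z$ is $T_\Omega(z)=\overline{\bigcup_{\tau>0}\{h:\Omega(z+\tau h)\le\Omega(z)\}}$, and the statistical dimension of $\Omega$ at $z$ is $\mathfrak S(z,\Omega)=\mathbb E\,\|\Pi_{T_\Omega(z)}(G)\|_2^2$, where $G$ is a standard Gaussian vector in $\mathbb R^p$ and $\Pi_{T_\Omega(z)}$ is the orthogonal projection onto $T_\Omega(z)$. (i) Let $w\in\mathbb R^p$ be a vector with at least $k$ nonzero entries that is $s$-sparse, that is, $k\le\|w\|_0\le s\le p$ (in particular, this covers $\|w\|_0=s\ge k$). Let $\tilde w$ be the vector obtained by sorting the entries of $w$ by decreasing absolute value. Then there is a unique integer $r\in\{0,\dots,k-1\}$ with $$|\tilde w_{k-r-1}|>\frac1{r+1}\sum_{i=k-r}^p|\tilde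 w_i|\ \ge\ |\tilde w_{k-r}|\qquad(\text{convention }|\tilde w_0|=\infty),$$ and, with $I_2=\{1,\dots,k-r-1\}$ and $I_1=\{k-r,\dots,s\}$, $$\mathfrak S(w,\theta_k)\le\frac54 s+2\left\{\frac{(r+1)^2\,\|\tilde w_{I_2}\|_2^2}{\|\tilde w_{I_1}\|_1^2}+|I_1|\right\}\log\frac ps .$$ (ii) In particular, for every $a\in\mathcal A_k^p$ with exactly $k$ nonzero entries and strength $\gamma=k\min_{i:\,a_i\ne0}a_i^2$, $$\mathfrak S(a,\theta_k)\le\frac54 k+\frac{2k}{\gamma}\log\frac pk .$$ -/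

import Mathlib

open MeasureTheory ProbabilityTheory Finset

noncomputable section

namespace KSupport

/-- The number `‖w‖₀` of nonzero coordinates of a vector. -/
def nnz {p : ℕ} (w : EuclideanSpace ℝ (Fin p)) : ℕ :=
  Set.ncard {i : Fin p | w i ≠ 0}

/-- The atoms `𝒜_k^p`: unit vectors of `ℝ^p` with at most `k` nonzero coordinates. -/
def atoms (p k : ℕ) : Set (EuclideanSpace ℝ (Fin p)) :=
  {a | nnz a ≤ k ∧ ‖a‖ = 1}

/-- The `k`-support norm `θ_k` on `ℝ^p`, i.e. the atomic norm induced by `𝒜_k^p`: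
`θ_k(x) = inf {t > 0 : x ∈ t • conv 𝒜_k^p}`. -/
def kSupportNorm {p : ℕ} (k : ℕ) (x : EuclideanSpace ℝ (Fin p)) : ℝ :=
  gauge (convexHull ℝ (atoms p k)) x

/-- The strength `k * min_{i ∈ supp a} a_i ^ 2` of an atom. -/
def strength {p : ℕ} (k : ℕ) (a : EuclideanSpace ℝ (Fin p)) : ℝ :=
  k * sInf ((fun i => (a i) ^ 2) '' {i : Fin p | a i ≠ 0})

/-- The tangent cone of `Ω` at `z`: the closure of the cone of descent directions. -/
def tangentCone {E : Type*} [NormedAddCommGroup E] [NormedSpace ℝ E] (Ω : E → ℝ) (z : E) :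
    Set E :=
  closure (⋃ τ ∈ Set.Ioi (0 : ℝ), {h : E | Ω (z + τ • h) ≤ Ω z})

/-- The orthogonal (nearest point) projection of `g` onto the set `K`. -/
def proj {E : Type*} [NormedAddCommGroup E] (K : Set E) (g : E) : E :=
  Classical.epsilon fun u => u ∈ K ∧ ∀ v ∈ K, ‖g - u‖ ≤ ‖g - v‖

/-- Onto a nonempty closed set of a finite dimensional space, `proj` is a nearest point. -/
theorem proj_spec {E : Type*} [NormedAddCommGroup E] [NormedSpace ℝ E] [FiniteDimensional ℝ E]
    {K : Set E} (hK : IsClosed K) (hne : K.Nonempty) (g : E) :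
    proj K g ∈ K ∧ ∀ v ∈ K, ‖g - proj K g‖ ≤ ‖g - v‖ := by
  have : ProperSpace E := FiniteDimensional.proper_real E
  obtain ⟨u, hu, h⟩ := hK.exists_infDist_eq_dist hne g
  refine Classical.epsilon_spec
    (p := fun u => u ∈ K ∧ ∀ v ∈ K, ‖g - u‖ ≤ ‖g - v‖) ⟨u, hu, fun v hv => ?_⟩
  rw [← dist_eq_norm, ← dist_eq_norm, ← h]
  exact Metric.infDist_le_dist_of_mem hv

/-- The statistical dimension `𝔖(z, Ω) = 𝔼 ‖Π_{T_Ω(z)}(G)‖²` of `Ω` at `z ∈ ℝ^p`, where `G` is a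
standard Gaussian vector and `Π` the orthogonal projection. -/
def statisticalDimension {p : ℕ} (z : EuclideanSpace ℝ (Fin p))
    (Ω : EuclideanSpace ℝ (Fin p) → ℝ) : ENNReal :=
  ∫⁻ g, ENNReal.ofReal (‖proj (tangentCone Ω z) g‖ ^ 2)
    ∂(stdGaussian (EuclideanSpace ℝ (Fin p)))

/-- The `i`-th entry, `1 ≤ i ≤ p`, of the vector `w̃` obtained from `w` by sorting its entries by
decreasing absolute values (and `0` for the other `i`). -/
def sortedEntry {p : ℕ} (w : EuclideanSpace ℝ (Fin p)) (i : ℕ) : ℝ :=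
  if h : 1 ≤ i ∧ i ≤ p then w (Tuple.sort (fun j => -|w j|) ⟨i - 1, by omega⟩) else 0

/-- `r ∈ {0, …, k - 1}` satisfies
`|w̃_{k-r-1}| > (1 / (r+1)) ∑_{i=k-r}^p |w̃_i| ≥ |w̃_{k-r}|`, with the convention `|w̃_0| = ∞`. -/
def IsIndex {p : ℕ} (k : ℕ) (w : EuclideanSpace ℝ (Fin p)) (r : ℕ) : Prop :=
  r < k ∧
  (k - r - 1 = 0 ∨
    1 / ((r : ℝ) + 1) * ∑ i ∈ Icc (k - r) p, |sortedEntry w i| < |sortedEntry w (k - r - 1)|) ∧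
  |sortedEntry w (k - r)| ≤ 1 / ((r : ℝ) + 1) * ∑ i ∈ Icc (k - r) p, |sortedEntry w i|

end KSupport

end

/-!
The projection of `g` onto the tangent cone at `w` is no longer than `g - y` for any `y` in the
normal cone, so the statistical dimension is at most `𝔼 ‖G - y(G)‖²` for any choice of normal
vectors `y(G)`. Write `B` for the positions of the `k - r - 1` largest entries and `A` for the
average `(1 / (r + 1)) ∑_{i ≥ k - r} |w̃_i|`. Then `θ_k(w)² = ∑_B w_i² + (r + 1) A²`, and for every
`τ ≥ 0` a vector `y` is normal at `w` as soon as it is `(τ / A) w_i` on `B`, `τ sign(w_i)` on the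
rest of the support, and at most `τ` in absolute value elsewhere. Off the support the best choice
clips `G_i` to `[-τ, τ]`, which leaves the soft thresholding of `G_i`, and `τ² = 2 log (p / s)`
makes the total contribution of those coordinates at most `s / 4`.
-/

namespace KSupport

section Cone

variable {E : Type*} [NormedAddCommGroup E]

lemma zero_mem_tangentCone [NormedSpace ℝ E] (Ω : E → ℝ) (z : E) : 0 ∈ tangentCone Ω z :=
  subset_closure (Set.mem_biUnion (Set.mem_Ioi.2 one_pos) (by simp))

lemma smul_mem_tangentCone [NormedSpace ℝ E] {Ω : E → ℝ} {z h : E} (hh : h ∈ tangentCone Ω z)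
    {c : ℝ} (hc : 0 < c) : c • h ∈ tangentCone Ω z := by
  refine map_mem_closure (continuous_const_smul c) hh fun h hh => ?_
  obtain ⟨τ, hτ, hle⟩ := Set.mem_iUnion₂.1 hh
  refine Set.mem_biUnion (Set.mem_Ioi.2 (div_pos hτ hc)) ?_
  rwa [Set.mem_ofPred_eq, smul_smul, div_mul_cancel₀ _ hc.ne']

variable [InnerProductSpace ℝ E]

/-- The normal cone of `Ω` at `z`, defined as the polar of the tangent cone: the distance of `g` to
any of its elements bounds the projection of `g` onto the tangent cone. -/
def normalCone (Ω : E → ℝ) (z : E) : Set E :=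
  {y | ∀ h ∈ tangentCone Ω z, inner ℝ y h ≤ 0}

lemma mem_normalCone_of_inner_le_mul {Ω : E → ℝ} {z y : E} {M : ℝ} (hM : 0 ≤ M)
    (hle : ∀ x, inner ℝ y x ≤ M * Ω x) (hz : M * Ω z ≤ inner ℝ y z) : y ∈ normalCone Ω z := by
  refine closure_minimal (Set.iUnion₂_subset fun τ hτ h hh => ?_)
    (isClosed_le (by fun_prop) continuous_const : IsClosed {h : E | inner ℝ y h ≤ 0})
  have hdescent : inner ℝ y (z + τ • h) ≤ inner ℝ y z :=
    calc inner ℝ y (z + τ • h) ≤ M * Ω (z + τ • h) := hle _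
      _ ≤ M * Ω z := mul_le_mul_of_nonneg_left hh hM
      _ ≤ inner ℝ y z := hz
  rw [inner_add_right, inner_smul_right, add_le_iff_nonpos_right] at hdescent
  exact nonpos_of_mul_nonpos_right hdescent hτ

lemma inner_eq_norm_sq_of_forall_norm_sub_le_smul {g u : E}
    (hu : ∀ c : ℝ, 0 < c → ‖g - u‖ ≤ ‖g - c • u‖) : inner ℝ g u = ‖u‖ ^ 2 := by
  let f : ℝ → ℝ := fun c => ‖g‖ ^ 2 - 2 * (c * inner ℝ g u) + c ^ 2 * ‖u‖ ^ 2
  have hf (c : ℝ) : ‖g - c • u‖ ^ 2 = f c := by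
    rw [norm_sub_sq_real, inner_smul_right, norm_smul, mul_pow, Real.norm_eq_abs, sq_abs]
  have hmin : IsLocalMin f 1 := by
    filter_upwards [lt_mem_nhds (one_pos : (0 : ℝ) < 1)] with c hc
    rw [← hf, ← hf, one_smul]
    gcongr
    exact hu c hc
  have hderiv : HasDerivAt f (-(2 * inner ℝ g u) + 2 * ‖u‖ ^ 2) 1 := by
    simpa [f] using ((((hasDerivAt_id (1 : ℝ)).mul_const (inner ℝ g u)).const_mul 2).const_sub
      (‖g‖ ^ 2)).fun_add ((hasDerivAt_pow 2 (1 : ℝ)).mul_const (‖u‖ ^ 2))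
  linarith [hmin.hasDerivAt_eq_zero hderiv]

lemma norm_proj_tangentCone_le_norm_sub [FiniteDimensional ℝ E] {Ω : E → ℝ} {z y : E}
    (hy : y ∈ normalCone Ω z) (g : E) : ‖proj (tangentCone Ω z) g‖ ≤ ‖g - y‖ := by
  obtain ⟨hu, hmin⟩ := proj_spec (K := tangentCone Ω z) isClosed_closure
    ⟨0, zero_mem_tangentCone Ω z⟩ g
  set u := proj (tangentCone Ω z) g
  have hgu : inner ℝ g u = ‖u‖ ^ 2 := inner_eq_norm_sq_of_forall_norm_sub_le_smul fun c hc =>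
    hmin _ (smul_mem_tangentCone hu hc)
  have hle : ‖u‖ * ‖u‖ ≤ ‖g - y‖ * ‖u‖ :=
    calc ‖u‖ * ‖u‖ = inner ℝ g u := by rw [hgu, sq]
      _ ≤ inner ℝ (g - y) u := by rw [inner_sub_left]; linarith [hy u hu]
      _ ≤ ‖g - y‖ * ‖u‖ := real_inner_le_norm _ _
  rcases (norm_nonneg u).eq_or_lt with hu0 | hu0
  · exact hu0 ▸ norm_nonneg _
  · exact le_of_mul_le_mul_right hle hu0

end Cone

section Gauge

lemma le_mul_gauge_convexHull {E : Type*} [AddCommGroup E] [Module ℝ E] {S : Set E}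
    (hS : Absorbent ℝ (convexHull ℝ S)) (f : E →ₗ[ℝ] ℝ) {M : ℝ} (hM : 0 ≤ M)
    (hf : ∀ a ∈ S, f a ≤ M) (x : E) : f x ≤ M * gauge (convexHull ℝ S) x := by
  have hhull : ∀ c ∈ convexHull ℝ S, f c ≤ M := fun c hc =>
    convexHull_min hf (convex_halfSpace_le f.isLinear M) hc
  have hlt (t : ℝ) (ht : gauge (convexHull ℝ S) x < t) : f x ≤ M * t := by
    obtain ⟨b, hb, hbt, c, hc, rfl⟩ := exists_lt_of_gauge_lt hS ht
    calc f (b • c) = b * f c := by simp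
      _ ≤ b * M := mul_le_mul_of_nonneg_left (hhull c hc) hb.le
      _ ≤ M * t := by rw [mul_comm]; exact mul_le_mul_of_nonneg_left hbt.le hM
  have hlim : Filter.Tendsto (fun t => M * t) (nhdsWithin (gauge (convexHull ℝ S) x)
      (Set.Ioi (gauge (convexHull ℝ S) x))) (nhds (M * gauge (convexHull ℝ S) x)) :=
    ((continuous_const_mul M).tendsto _).mono_left nhdsWithin_le_nhds
  exact ge_of_tendsto hlim (eventually_nhdsWithin_of_forall hlt)

lemma gauge_convexHull_le_of_forall_dual {E : Type*} [NormedAddCommGroup E] [NormedSpace ℝ E]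
    {S : Set E} (hS : convexHull ℝ S ∈ nhds 0) {x : E} {t : ℝ} (ht : 0 < t)
    (hx : ∀ f : StrongDual ℝ E, ∃ a ∈ S, f x ≤ t * f a) : gauge (convexHull ℝ S) x ≤ t := by
  have hmem : t⁻¹ • x ∈ closure (convexHull ℝ S) := by
    by_contra hnot
    obtain ⟨f, u, hf, hu⟩ := geometric_hahn_banach_closed_point
      (convex_convexHull ℝ S).closure isClosed_closure hnot
    obtain ⟨a, ha, hax⟩ := hx f
    rw [map_smul, smul_eq_mul] at hu
    linarith [hf a (subset_closure (subset_convexHull ℝ S ha)), (inv_mul_le_iff₀ ht).2 hax]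
  rwa [← gauge_le_one_iff_mem_closure (convex_convexHull ℝ S) hS,
    gauge_smul_of_nonneg (inv_nonneg.2 ht.le), smul_eq_mul, inv_mul_le_iff₀ ht, mul_one] at hmem

end Gauge

section Gaussian

lemma lintegral_gaussianReal_sub_sq (μ : ℝ) (v : NNReal) (c : ℝ) :
    ∫⁻ x, ENNReal.ofReal ((x - c) ^ 2) ∂gaussianReal μ v = ENNReal.ofReal (v + (μ - c) ^ 2) := by
  have hid : MemLp (fun x : ℝ => x) 2 (gaussianReal μ v) := memLp_id_gaussianReal 2
  have hLp : MemLp (fun x : ℝ => x - c) 2 (gaussianReal μ v) := hid.sub (memLp_const c)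
  have hmean : ∫ x, (x - c) ∂gaussianReal μ v = μ - c := by
    rw [integral_sub (hid.integrable one_le_two) (integrable_const c)]
    simp
  have hvar := variance_eq_sub hLp
  rw [variance_sub_const hid.aestronglyMeasurable, variance_fun_id_gaussianReal, hmean] at hvar
  rw [← ofReal_integral_eq_lintegral_ofReal hLp.integrable_sq (ae_of_all _ fun x => sq_nonneg _)]
  congr 1
  simp only [Pi.pow_apply] at hvar
  linarith

-- `ENNReal.ofReal` truncates the integrand to `0` on the negative half-line.
lemma lintegral_ofReal_mul_exp_neg_sq_half :
    ∫⁻ x : ℝ, ENNReal.ofReal (x * Real.exp (-(x ^ 2 / 2))) = 1 := by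
  have hint : ∫ x in Set.Ioi (0 : ℝ), x * Real.exp (-(x ^ 2 / 2)) = 1 := by
    have hgamma := integral_rpow_mul_exp_neg_mul_rpow (p := 2) (q := 1) (b := 1 / 2)
      (by norm_num) (by norm_num) (by norm_num)
    norm_num at hgamma
    rw [← hgamma]
    congr 1 with x
    congr 2
    ring
  have hsupp : (fun x : ℝ => ENNReal.ofReal (x * Real.exp (-(x ^ 2 / 2)))).support ⊆
      Set.Ioi 0 := by
    intro x hx
    rw [Function.mem_support, ← pos_iff_ne_zero, ENNReal.ofReal_pos] at hx
    exact pos_of_mul_pos_left hx (Real.exp_pos _).le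
  rw [← setLIntegral_eq_of_support_subset hsupp, ← ofReal_integral_eq_lintegral_ofReal
    (Integrable.of_integral_ne_zero (hint ▸ one_ne_zero)), hint, ENNReal.ofReal_one]
  filter_upwards [ae_restrict_mem measurableSet_Ioi] with x hx
  exact mul_nonneg (le_of_lt hx) (Real.exp_pos _).le

/-- The truncation of `x` to `[-τ, τ]`, so that `x - clip τ x` is the soft thresholding of `x`
at level `τ`. -/
def clip (τ x : ℝ) : ℝ := max (-τ) (min x τ)

@[fun_prop]
lemma measurable_clip (τ : ℝ) : Measurable (clip τ) := by
  unfold clip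
  fun_prop

lemma abs_clip_le {τ : ℝ} (hτ : 0 ≤ τ) (x : ℝ) : |clip τ x| ≤ τ :=
  abs_le.2 ⟨le_max_left _ _, max_le (by linarith) (min_le_right _ _)⟩

lemma clip_of_le {τ x : ℝ} (hτ : 0 ≤ τ) (hx : τ ≤ x) : clip τ x = τ := by
  rw [clip, min_eq_right hx, max_eq_right (by linarith)]

lemma clip_of_le_neg {τ x : ℝ} (hτ : 0 ≤ τ) (hx : x ≤ -τ) : clip τ x = -τ := by
  rw [clip, min_eq_left (by linarith), max_eq_left hx]

lemma clip_of_abs_le {τ x : ℝ} (hx : |x| ≤ τ) : clip τ x = x := by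
  rw [clip, min_eq_left (abs_le.1 hx).2, max_eq_right (abs_le.1 hx).1]

/-- The constant in the bound `2 * thresholdConst τ` on the second moment of the soft thresholding
at level `τ` of a standard Gaussian variable. -/
noncomputable def thresholdConst (τ : ℝ) : ℝ :=
  Real.exp (-(τ ^ 2 / 2)) / (Real.exp 1 * τ * √(2 * Real.pi))

lemma thresholdConst_nonneg {τ : ℝ} (hτ : 0 ≤ τ) : 0 ≤ thresholdConst τ := by
  unfold thresholdConst
  positivity

-- From `u * exp (-(u * τ)) ≤ 1 / (e * τ)`, one factor `u` is absorbed by the cross term of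
-- `exp (-(u + τ) ^ 2 / 2)`; what remains is integrable in closed form.
lemma gaussianPDFReal_add_mul_sq_le {τ u : ℝ} (hτ : 0 < τ) (hu : 0 ≤ u) :
    gaussianPDFReal 0 1 (u + τ) * u ^ 2 ≤
      thresholdConst τ * (u * Real.exp (-(u ^ 2 / 2))) := by
  have hexp : u * τ * Real.exp 1 ≤ Real.exp (u * τ) := by
    have := Real.add_one_le_exp (u * τ - 1)
    rw [Real.exp_sub, le_div_iff₀ (Real.exp_pos _)] at this
    linarith
  have habsorb : u * Real.exp (-(u * τ)) ≤ 1 / (Real.exp 1 * τ) := by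
    rw [Real.exp_neg, ← div_eq_mul_inv, div_le_div_iff₀ (Real.exp_pos _) (by positivity)]
    linarith
  have hpdf : gaussianPDFReal 0 1 (u + τ) = (√(2 * Real.pi))⁻¹ *
      (Real.exp (-(u ^ 2 / 2)) * Real.exp (-(u * τ)) * Real.exp (-(τ ^ 2 / 2))) := by
    rw [gaussianPDFReal, ← Real.exp_add, ← Real.exp_add]
    simp only [NNReal.coe_one, mul_one, sub_zero]
    congr 2
    ring
  calc gaussianPDFReal 0 1 (u + τ) * u ^ 2
      = (√(2 * Real.pi))⁻¹ * Real.exp (-(τ ^ 2 / 2)) * (u * Real.exp (-(u ^ 2 / 2))) *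
          (u * Real.exp (-(u * τ))) := by rw [hpdf]; ring
    _ ≤ (√(2 * Real.pi))⁻¹ * Real.exp (-(τ ^ 2 / 2)) * (u * Real.exp (-(u ^ 2 / 2))) *
          (1 / (Real.exp 1 * τ)) := by gcongr
    _ = thresholdConst τ * (u * Real.exp (-(u ^ 2 / 2))) := by rw [thresholdConst]; field_simp

lemma gaussianPDF_mul_softThreshold_sq_le {τ : ℝ} (hτ : 0 < τ) (x : ℝ) :
    gaussianPDF 0 1 x * ENNReal.ofReal ((x - clip τ x) ^ 2) ≤
      ENNReal.ofReal (thresholdConst τ) *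
        (ENNReal.ofReal ((x - τ) * Real.exp (-((x - τ) ^ 2 / 2))) +
          ENNReal.ofReal ((-τ - x) * Real.exp (-((-τ - x) ^ 2 / 2)))) := by
  have hconst := thresholdConst_nonneg hτ.le
  rw [gaussianPDF, ← ENNReal.ofReal_mul (gaussianPDFReal_nonneg _ _ _), mul_add,
    ← ENNReal.ofReal_mul hconst, ← ENNReal.ofReal_mul hconst]
  rcases le_total τ x with hx | hx
  · refine le_add_right (ENNReal.ofReal_le_ofReal ?_)
    simpa only [clip_of_le hτ.le hx, sub_add_cancel] using
      gaussianPDFReal_add_mul_sq_le hτ (sub_nonneg.2 hx)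
  rcases le_total x (-τ) with hx' | hx'
  · refine le_add_left (ENNReal.ofReal_le_ofReal ?_)
    have heven : gaussianPDFReal 0 1 (-τ - x + τ) = gaussianPDFReal 0 1 x := by
      have hsq : (-τ - x + τ) ^ 2 = x ^ 2 := by ring
      simp only [gaussianPDFReal, sub_zero, hsq]
    have hsq : (-τ - x) ^ 2 = (x - clip τ x) ^ 2 := by rw [clip_of_le_neg hτ.le hx']; ring
    simpa only [heven, hsq] using gaussianPDFReal_add_mul_sq_le hτ (sub_nonneg.2 hx')
  · simp [clip_of_abs_le (abs_le.2 ⟨hx', hx⟩)]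

lemma lintegral_gaussianReal_softThreshold_sq_le {τ : ℝ} (hτ : 0 < τ) :
    ∫⁻ x, ENNReal.ofReal ((x - clip τ x) ^ 2) ∂gaussianReal 0 1 ≤
      ENNReal.ofReal (2 * thresholdConst τ) := by
  let G : ℝ → ENNReal := fun x => ENNReal.ofReal (x * Real.exp (-(x ^ 2 / 2)))
  have hG : Measurable G := by fun_prop
  rw [gaussianReal_of_var_ne_zero _ one_ne_zero,
    lintegral_withDensity_eq_lintegral_mul _ (measurable_gaussianPDF _ _) (by fun_prop)]
  calc ∫⁻ x, gaussianPDF 0 1 x * ENNReal.ofReal ((x - clip τ x) ^ 2)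
      ≤ ∫⁻ x, ENNReal.ofReal (thresholdConst τ) * (G (x - τ) + G (-τ - x)) :=
        lintegral_mono (gaussianPDF_mul_softThreshold_sq_le hτ)
    _ = ENNReal.ofReal (thresholdConst τ) * ((∫⁻ x, G x) + ∫⁻ x, G x) := by
        rw [lintegral_const_mul _ (by fun_prop), lintegral_add_left (by fun_prop),
          lintegral_sub_right_eq_self G, lintegral_sub_left_eq_self G]
    _ = ENNReal.ofReal (2 * thresholdConst τ) := by
        rw [lintegral_ofReal_mul_exp_neg_sq_half, one_add_one_eq_two, mul_comm,
          ENNReal.ofReal_mul zero_le_two, ENNReal.ofReal_ofNat]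

lemma lintegral_stdGaussian_eval {ι : Type*} [Fintype ι] (i : ι) {f : ℝ → ENNReal}
    (hf : Measurable f) :
    ∫⁻ g, f (g i) ∂stdGaussian (EuclideanSpace ℝ ι) = ∫⁻ x, f x ∂gaussianReal 0 1 := by
  rw [← map_pi_eq_stdGaussian, lintegral_map (by fun_prop) (by fun_prop),
    ← (measurePreserving_eval (fun _ : ι => gaussianReal 0 1) i).lintegral_comp hf]

lemma statisticalDimension_le_sum_lintegral {p : ℕ} {Ω : EuclideanSpace ℝ (Fin p) → ℝ}
    {z : EuclideanSpace ℝ (Fin p)} {η : Fin p → ℝ → ℝ} (hη : ∀ i, Measurable (η i))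
    (hmem : ∀ g : EuclideanSpace ℝ (Fin p), WithLp.toLp 2 (fun i => η i (g i)) ∈ normalCone Ω z) :
    statisticalDimension z Ω ≤
      ∑ i, ∫⁻ x, ENNReal.ofReal ((x - η i x) ^ 2) ∂gaussianReal 0 1 := by
  have hpt (g : EuclideanSpace ℝ (Fin p)) :
      ENNReal.ofReal (‖proj (tangentCone Ω z) g‖ ^ 2) ≤
        ∑ i, ENNReal.ofReal ((g i - η i (g i)) ^ 2) := by
    rw [← ENNReal.ofReal_sum_of_nonneg fun i _ => sq_nonneg _]
    refine ENNReal.ofReal_le_ofReal ?_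
    calc ‖proj (tangentCone Ω z) g‖ ^ 2
        ≤ ‖g - WithLp.toLp 2 fun i => η i (g i)‖ ^ 2 := by
          gcongr
          exact norm_proj_tangentCone_le_norm_sub (hmem g) g
      _ = ∑ i, (g i - η i (g i)) ^ 2 := by simp [EuclideanSpace.real_norm_sq_eq]
  have hmeas (i : Fin p) : Measurable fun x => ENNReal.ofReal ((x - η i x) ^ 2) := by fun_prop
  calc statisticalDimension z Ω
      ≤ ∫⁻ g, ∑ i, ENNReal.ofReal ((g i - η i (g i)) ^ 2)
          ∂stdGaussian (EuclideanSpace ℝ (Fin p)) := lintegral_mono hpt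
    _ = ∑ i, ∫⁻ g, ENNReal.ofReal ((g i - η i (g i)) ^ 2)
          ∂stdGaussian (EuclideanSpace ℝ (Fin p)) :=
        lintegral_finsetSum _ fun i _ => (hmeas i).comp (by fun_prop)
    _ = ∑ i, ∫⁻ x, ENNReal.ofReal ((x - η i x) ^ 2) ∂gaussianReal 0 1 :=
        sum_congr rfl fun i _ => lintegral_stdGaussian_eval i (hmeas i)

end Gaussian

lemma abs_coe_sign_le_one (a : ℝ) : |(SignType.sign a : ℝ)| ≤ 1 := by
  rcases lt_trichotomy a 0 with h | h | h <;> simp [h]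

section Atoms

variable {p k : ℕ}

lemma nnz_eq_card_filter (w : EuclideanSpace ℝ (Fin p)) : nnz w = #{i | w i ≠ 0} := by
  rw [nnz, ← Set.ncard_coe_finset, Finset.coe_filter_univ]

lemma nnz_le_card {w : EuclideanSpace ℝ (Fin p)} {F : Finset (Fin p)}
    (hF : ∀ i ∉ F, w i = 0) : nnz w ≤ #F := by
  rw [nnz_eq_card_filter]
  refine card_le_card fun i hi => ?_
  by_contra hiF
  exact (mem_filter.1 hi).2 (hF i hiF)

lemma nnz_le (w : EuclideanSpace ℝ (Fin p)) : nnz w ≤ p :=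
  (nnz_le_card (F := univ) (by simp)).trans_eq (by simp)

lemma single_mem_atoms (hk : 1 ≤ k) (i : Fin p) {c : ℝ} (hc : |c| = 1) :
    EuclideanSpace.single i c ∈ atoms p k :=
  ⟨(nnz_le_card (F := {i}) fun j hj => by simp [mem_singleton.not.1 hj]).trans (by simpa using hk),
    by simp [hc]⟩

lemma single_mem_convexHull_atoms (hk : 1 ≤ k) (i : Fin p) {c : ℝ} (hc : |c| ≤ 1) :
    EuclideanSpace.single i c ∈ convexHull ℝ (atoms p k) := by
  obtain ⟨hc₁, hc₂⟩ := abs_le.1 hc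
  have hmem (e : ℝ) (he : |e| = 1) : EuclideanSpace.single i e ∈ convexHull ℝ (atoms p k) :=
    subset_convexHull ℝ _ (single_mem_atoms hk i he)
  convert convex_convexHull ℝ (atoms p k) (hmem 1 (by simp)) (hmem (-1) (by simp))
    (a := (1 + c) / 2) (b := (1 - c) / 2) (by linarith) (by linarith) (by ring) using 1
  ext j
  by_cases hj : j = i
  · subst hj; simp; ring
  · simp [hj]

lemma convexHull_atoms_mem_nhds (hk : 1 ≤ k) (hp : 0 < p) :
    convexHull ℝ (atoms p k) ∈ nhds (0 : EuclideanSpace ℝ (Fin p)) := by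
  have hp' : (p : ℝ) ≠ 0 := by positivity
  have hsmall : ∀ᶠ x : EuclideanSpace ℝ (Fin p) in nhds 0, ∀ i, |(p : ℝ) * x i| < 1 := by
    refine Filter.eventually_all.2 fun i => ?_
    have hcont : Continuous fun x : EuclideanSpace ℝ (Fin p) => |(p : ℝ) * x i| := by fun_prop
    exact hcont.continuousAt.eventually_lt continuousAt_const (by simp)
  filter_upwards [hsmall] with x hx
  convert (convex_convexHull ℝ (atoms p k)).sum_mem (t := univ) (w := fun _ : Fin p => (p : ℝ)⁻¹)
    (z := fun i => EuclideanSpace.single i ((p : ℝ) * x i)) (fun _ _ => by positivity)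
    (by simp [hp']) (fun i _ => single_mem_convexHull_atoms hk i (hx i).le) using 1
  ext j
  simp [Pi.single_apply, hp']

lemma exists_inner_le_sqrt_of_mem_atoms {a : EuclideanSpace ℝ (Fin p)} (ha : a ∈ atoms p k)
    (y : EuclideanSpace ℝ (Fin p)) :
    ∃ F : Finset (Fin p), #F ≤ k ∧ inner ℝ y a ≤ √(∑ i ∈ F, y i ^ 2) := by
  refine ⟨({i | a i ≠ 0} : Finset (Fin p)), nnz_eq_card_filter a ▸ ha.1, ?_⟩
  have hsupp : inner ℝ y a = ∑ i with a i ≠ 0, y i * a i := by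
    rw [PiLp.inner_apply, sum_filter]
    exact sum_congr rfl fun i _ => by by_cases h : a i = 0 <;> simp [h, mul_comm]
  have hnorm : ∑ i with a i ≠ 0, a i ^ 2 ≤ 1 :=
    calc ∑ i with a i ≠ 0, a i ^ 2 ≤ ∑ i, a i ^ 2 :=
          sum_le_univ_sum_of_nonneg fun i => sq_nonneg _
      _ = 1 := by rw [← EuclideanSpace.real_norm_sq_eq, ha.2, one_pow]
  calc inner ℝ y a
      ≤ √(∑ i with a i ≠ 0, y i ^ 2) * √(∑ i with a i ≠ 0, a i ^ 2) :=
        hsupp ▸ Real.sum_mul_le_sqrt_mul_sqrt _ _ _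
    _ ≤ √(∑ i with a i ≠ 0, y i ^ 2) :=
        mul_le_of_le_one_right (Real.sqrt_nonneg _) (Real.sqrt_le_one.2 hnorm)

lemma exists_mem_atoms_inner_eq_sqrt {F : Finset (Fin p)} (hF : F.Nonempty) (hFk : #F ≤ k)
    (y : EuclideanSpace ℝ (Fin p)) : ∃ a ∈ atoms p k, inner ℝ y a = √(∑ i ∈ F, y i ^ 2) := by
  let b : EuclideanSpace ℝ (Fin p) := WithLp.toLp 2 fun i => if i ∈ F then y i else 0
  have hb : ∀ i ∉ F, b i = 0 := fun i hi => by simp [b, hi]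
  have hnorm : ‖b‖ = √(∑ i ∈ F, y i ^ 2) := by
    simp [EuclideanSpace.norm_eq, b, ite_pow, sum_ite_mem]
  have hinner : inner ℝ y b = ‖b‖ ^ 2 := by
    rw [EuclideanSpace.real_norm_sq_eq, PiLp.inner_apply]
    exact sum_congr rfl fun i _ => by by_cases hi : i ∈ F <;> simp [b, hi, sq]
  rw [← hnorm]
  by_cases hb0 : b = 0
  · obtain ⟨i, hi⟩ := hF
    have hyi : y i = 0 := by simpa [b, hi] using congrArg (· i) hb0
    exact ⟨EuclideanSpace.single i 1,
      single_mem_atoms ((card_pos.2 ⟨i, hi⟩).trans_le hFk) i (by simp), 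
        by simp [hb0, hyi, EuclideanSpace.inner_single_right]⟩
  · refine ⟨‖b‖⁻¹ • b, ⟨(nnz_le_card fun i hi => ?_).trans hFk, ?_⟩, ?_⟩
    · simp [hb i hi]
    · simp [norm_smul, hb0]
    · rw [inner_smul_right, hinner, sq, inv_mul_cancel_left₀ (norm_ne_zero_iff.2 hb0)]

end Atoms

section Rearrangement

variable {ι : Type*}

lemma exists_card_eq_forall_le_threshold {α : Type*} [LinearOrder α] [Nonempty α] (v : ι → α)
    (D : Finset ι) {m : ℕ} (hm : m ≤ #D) :
    ∃ J ⊆ D, #J = m ∧ ∃ c, (∀ i ∈ J, c ≤ v i) ∧ ∀ i ∈ D, i ∉ J → v i ≤ c := by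
  classical
  induction m with
  | zero =>
    obtain ⟨c, hc⟩ := (D.image v).exists_le
    exact ⟨∅, by simp, rfl, c, by simp, fun i hi _ => hc _ (mem_image_of_mem v hi)⟩
  | succ m ih =>
    obtain ⟨J, hJD, rfl, c, hcJ, hcD⟩ := ih (by omega)
    have hne : (D \ J).Nonempty := card_pos.1 (by rw [card_sdiff_of_subset hJD]; omega)
    obtain ⟨j, hj, hmax⟩ := exists_max_image (D \ J) v hne
    obtain ⟨hjD, hjJ⟩ := mem_sdiff.1 hj
    refine ⟨insert j J, insert_subset hjD hJD, card_insert_of_notMem hjJ, v j, ?_, ?_⟩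
    · exact (forall_mem_insert _ _ _).2 ⟨le_rfl, fun i hi => (hcD j hjD hjJ).trans (hcJ i hi)⟩
    · exact fun i hiD hi => hmax i (mem_sdiff.2 ⟨hiD, fun hiJ => hi (mem_insert_of_mem hiJ)⟩)

-- Moving all the mass of `u` onto the `m` largest values of `v`, at capacity `A` each, can only
-- increase the weighted sum.
lemma exists_card_eq_sum_mul_le (D : Finset ι) {m : ℕ} (hm : m ≤ #D) {u : ι → ℝ} (v : ι → ℝ)
    {A : ℝ} (hu : ∀ i ∈ D, 0 ≤ u i) (huA : ∀ i ∈ D, u i ≤ A) (hsum : ∑ i ∈ D, u i = m * A) :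
    ∃ J ⊆ D, #J = m ∧ ∑ i ∈ D, u i * v i ≤ A * ∑ i ∈ J, v i := by
  classical
  obtain ⟨J, hJD, rfl, c, hcJ, hcD⟩ := exists_card_eq_forall_le_threshold v D hm
  refine ⟨J, hJD, rfl, ?_⟩
  have houtside : ∑ i ∈ D \ J, u i * v i ≤ (∑ i ∈ D \ J, u i) * c := by
    rw [sum_mul]
    refine sum_le_sum fun i hi => ?_
    obtain ⟨hiD, hiJ⟩ := mem_sdiff.1 hi
    exact mul_le_mul_of_nonneg_left (hcD i hiD hiJ) (hu i hiD)
  have hinside : (∑ i ∈ J, (A - u i)) * c ≤ ∑ i ∈ J, (A - u i) * v i := by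
    rw [sum_mul]
    exact sum_le_sum fun i hi =>
      mul_le_mul_of_nonneg_left (hcJ i hi) (sub_nonneg.2 (huA i (hJD hi)))
  have hmass : ∑ i ∈ D \ J, u i = ∑ i ∈ J, (A - u i) := by
    rw [← sum_sdiff hJD] at hsum
    rw [sum_sub_distrib, sum_const, nsmul_eq_mul]
    linarith
  calc ∑ i ∈ D, u i * v i = ∑ i ∈ D \ J, u i * v i + ∑ i ∈ J, u i * v i := (sum_sdiff hJD).symm
    _ ≤ ∑ i ∈ J, (A - u i) * v i + ∑ i ∈ J, u i * v i := by
        gcongr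
        exact houtside.trans (hmass ▸ hinside)
    _ = A * ∑ i ∈ J, v i := by
        rw [← sum_add_distrib, mul_sum]
        exact sum_congr rfl fun i _ => by ring

lemma sum_sq_le_sum_sq_add {F B : Finset ι} {y : ι → ℝ} {A : ℝ} (hA : 0 ≤ A)
    (hB : ∀ i ∈ B, A ≤ |y i|) (hBc : ∀ i ∉ B, |y i| ≤ A) :
    ∑ i ∈ F, y i ^ 2 ≤ ∑ i ∈ B, y i ^ 2 + (#F - #B) * A ^ 2 := by
  classical
  have hexcess : ∑ i ∈ F, (y i ^ 2 - A ^ 2) ≤ ∑ i ∈ B, (y i ^ 2 - A ^ 2) :=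
    calc ∑ i ∈ F, (y i ^ 2 - A ^ 2)
        = ∑ i ∈ F with i ∈ B, (y i ^ 2 - A ^ 2) + ∑ i ∈ F with i ∉ B, (y i ^ 2 - A ^ 2) :=
          (sum_filter_add_sum_filter_not F (· ∈ B) _).symm
      _ ≤ ∑ i ∈ F with i ∈ B, (y i ^ 2 - A ^ 2) :=
          add_le_of_nonpos_right <| sum_nonpos fun i hi => sub_nonpos.2 <|
            sq_le_sq.2 <| (hBc i (mem_filter.1 hi).2).trans (le_abs_self A)
      _ ≤ ∑ i ∈ B, (y i ^ 2 - A ^ 2) :=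
          sum_le_sum_of_subset_of_nonneg (fun i hi => (mem_filter.1 hi).2) fun i hi _ =>
            sub_nonneg.2 <| sq_le_sq.2 <| (abs_of_nonneg hA).trans_le (hB i hi)
  simp only [sum_sub_distrib, sum_const, nsmul_eq_mul] at hexcess
  linarith

end Rearrangement

section HeadTail

lemma exists_card_eq_sum_mul_le_sqrt {ι : Type*} [Fintype ι] [DecidableEq ι] {B : Finset ι} {m : ℕ}
    (hm : m ≤ #Bᶜ) {w : ι → ℝ} (y : ι → ℝ) {A : ℝ} (hw : ∀ i ∉ B, |w i| ≤ A)
    (hsum : ∑ i ∈ Bᶜ, |w i| = m * A) :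
    ∃ J ⊆ Bᶜ, #J = m ∧
      ∑ i, y i * w i ≤ √(∑ i ∈ B, w i ^ 2 + m * A ^ 2) * √(∑ i ∈ B ∪ J, y i ^ 2) := by
  obtain ⟨J, hJB, rfl, hJ⟩ := exists_card_eq_sum_mul_le Bᶜ hm (fun i => |y i|)
    (fun i _ => abs_nonneg (w i)) (fun i hi => hw i (mem_compl.1 hi)) hsum
  refine ⟨J, hJB, rfl, ?_⟩
  have hBJ : Disjoint B J := disjoint_right.2 fun i hi => mem_compl.1 (hJB hi)
  let c : ι → ℝ := fun i => if i ∈ B then |w i| else A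
  have hcB : ∀ i ∈ B, c i = |w i| := fun i hi => if_pos hi
  have hcJ : ∀ i ∈ J, c i = A := fun i hi => if_neg (mem_compl.1 (hJB hi))
  have hc : ∑ i ∈ B ∪ J, c i ^ 2 = ∑ i ∈ B, w i ^ 2 + #J * A ^ 2 := by
    rw [sum_union hBJ, sum_congr rfl fun i hi => by rw [hcB i hi, sq_abs],
      sum_congr (s₁ := J) rfl fun i hi => by rw [hcJ i hi], sum_const, nsmul_eq_mul]
  calc ∑ i, y i * w i
      ≤ ∑ i, |w i| * |y i| :=
        sum_le_sum fun i _ => (le_abs_self _).trans_eq (by rw [abs_mul, mul_comm])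
    _ = ∑ i ∈ B, |w i| * |y i| + ∑ i ∈ Bᶜ, |w i| * |y i| := (sum_add_sum_compl B _).symm
    _ ≤ ∑ i ∈ B, |w i| * |y i| + A * ∑ i ∈ J, |y i| := by gcongr
    _ = ∑ i ∈ B ∪ J, c i * |y i| := by
        rw [sum_union hBJ, mul_sum]
        exact congrArg₂ _ (sum_congr rfl fun i hi => by rw [hcB i hi])
          (sum_congr rfl fun i hi => by rw [hcJ i hi])
    _ ≤ √(∑ i ∈ B ∪ J, c i ^ 2) * √(∑ i ∈ B ∪ J, |y i| ^ 2) := Real.sum_mul_le_sqrt_mul_sqrt _ _ _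
    _ = √(∑ i ∈ B, w i ^ 2 + #J * A ^ 2) * √(∑ i ∈ B ∪ J, y i ^ 2) := by simp only [hc, sq_abs]

variable {p k : ℕ} {w : EuclideanSpace ℝ (Fin p)} {B C : Finset (Fin p)} {A τ : ℝ}

/-- The entries of `w` split at level `A` into a head, on `B`, and a tail whose total mass is that
of `k - #B` entries equal to `A`. This is the decomposition that realizes the `k`-support norm. -/
structure IsHeadTailSplit (k : ℕ) (w : EuclideanSpace ℝ (Fin p)) (B : Finset (Fin p)) (A : ℝ) :
    Prop where
  card_lt : #B < k
  pos : 0 < A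
  le_of_mem : ∀ i ∈ B, A ≤ |w i|
  le_of_notMem : ∀ i ∉ B, |w i| ≤ A
  sum_compl : ∑ i ∈ Bᶜ, |w i| = (k - #B : ℝ) * A

/-- The square of the `k`-support norm of the vector `w` with head `B` and level `A`. -/
def headTailSq (k : ℕ) (w : EuclideanSpace ℝ (Fin p)) (B : Finset (Fin p)) (A : ℝ) : ℝ :=
  ∑ i ∈ B, w i ^ 2 + (k - #B : ℝ) * A ^ 2

namespace IsHeadTailSplit

lemma card_sub_card_pos (h : IsHeadTailSplit k w B A) : (0 : ℝ) < k - #B :=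
  sub_pos.2 (by exact_mod_cast h.card_lt)

lemma headTailSq_pos (h : IsHeadTailSplit k w B A) : 0 < headTailSq k w B A :=
  add_pos_of_nonneg_of_pos (sum_nonneg fun _ _ => sq_nonneg _)
    (mul_pos h.card_sub_card_pos (sq_pos_of_pos h.pos))

lemma le_card (h : IsHeadTailSplit k w B A) (hBC : B ⊆ C) (hC : ∀ i ∉ C, w i = 0) : k ≤ #C := by
  have hmass : (k - #B : ℝ) * A ≤ (#C - #B : ℝ) * A :=
    calc (k - #B : ℝ) * A = ∑ i ∈ Bᶜ, |w i| := h.sum_compl.symm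
      _ = ∑ i ∈ C \ B, |w i| := by
          refine (sum_subset (fun i hi => mem_compl.2 (mem_sdiff.1 hi).2) fun i hi hi' => ?_).symm
          rw [hC i fun hiC => hi' (mem_sdiff.2 ⟨hiC, mem_compl.1 hi⟩), abs_zero]
      _ ≤ #(C \ B) • A := sum_le_card_nsmul _ _ _ fun i hi => h.le_of_notMem i (mem_sdiff.1 hi).2
      _ = (#C - #B : ℝ) * A := by
          rw [nsmul_eq_mul, card_sdiff_of_subset hBC, Nat.cast_sub (card_le_card hBC)]
  exact_mod_cast (sub_le_sub_iff_right _).1 (le_of_mul_le_mul_right hmass h.pos)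

lemma le_dim (h : IsHeadTailSplit k w B A) : k ≤ p := by
  simpa using h.le_card (subset_univ B) (by simp)

lemma convexHull_atoms_mem_nhds (h : IsHeadTailSplit k w B A) :
    convexHull ℝ (atoms p k) ∈ nhds (0 : EuclideanSpace ℝ (Fin p)) :=
  KSupport.convexHull_atoms_mem_nhds (Nat.one_le_of_lt h.card_lt)
    ((Nat.zero_lt_of_lt h.card_lt).trans_le h.le_dim)

lemma exists_mem_atoms_inner_le (h : IsHeadTailSplit k w B A) (y : EuclideanSpace ℝ (Fin p)) :
    ∃ a ∈ atoms p k, inner ℝ y w ≤ √(headTailSq k w B A) * inner ℝ y a := by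
  have hBk := h.card_lt
  have hcast : ((k - #B : ℕ) : ℝ) = k - #B := Nat.cast_sub hBk.le
  obtain ⟨J, hJB, hJ, hle⟩ := exists_card_eq_sum_mul_le_sqrt (m := k - #B) (B := B)
    (by rw [card_compl, Fintype.card_fin]; exact Nat.sub_le_sub_right h.le_dim _) y
    h.le_of_notMem (hcast ▸ h.sum_compl)
  have hcard : #(B ∪ J) = k := by
    rw [card_union_of_disjoint (disjoint_right.2 fun i hi => mem_compl.1 (hJB hi)), hJ,
      Nat.add_sub_cancel' hBk.le]
  obtain ⟨a, ha, hya⟩ := exists_mem_atoms_inner_eq_sqrt (k := k)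
    (card_pos.1 (hcard ▸ Nat.zero_lt_of_lt hBk)) hcard.le y
  refine ⟨a, ha, ?_⟩
  rw [hya, headTailSq, ← hcast]
  exact (PiLp.inner_apply y w).trans_le ((sum_congr rfl fun i _ => mul_comm _ _).trans_le hle)

lemma kSupportNorm_le (h : IsHeadTailSplit k w B A) :
    kSupportNorm k w ≤ √(headTailSq k w B A) := by
  refine gauge_convexHull_le_of_forall_dual h.convexHull_atoms_mem_nhds
    (Real.sqrt_pos.2 h.headTailSq_pos) fun f => ?_
  simpa only [InnerProductSpace.toDual_symm_apply] using
    h.exists_mem_atoms_inner_le ((InnerProductSpace.toDual ℝ _).symm f)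

lemma inner_eq (h : IsHeadTailSplit k w B A) {y : EuclideanSpace ℝ (Fin p)}
    (hB : ∀ i ∈ B, y i = τ / A * w i) (hyw : ∀ i ∉ B, y i * w i = τ * |w i|) :
    inner ℝ y w = τ / A * headTailSq k w B A := by
  have hA := h.pos.ne'
  calc inner ℝ y w = ∑ i, y i * w i := by simp [PiLp.inner_apply, mul_comm]
    _ = ∑ i ∈ B, τ / A * w i ^ 2 + ∑ i ∈ Bᶜ, τ * |w i| := by
        rw [← sum_add_sum_compl B]
        exact congrArg₂ _ (sum_congr rfl fun i hi => by rw [hB i hi]; ring)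
          (sum_congr rfl fun i hi => hyw i (mem_compl.1 hi))
    _ = τ / A * headTailSq k w B A := by
        rw [← mul_sum, ← mul_sum, h.sum_compl, headTailSq]
        field_simp

lemma inner_le_of_mem_atoms (h : IsHeadTailSplit k w B A) (hτ : 0 ≤ τ)
    {y : EuclideanSpace ℝ (Fin p)} (hB : ∀ i ∈ B, y i = τ / A * w i)
    (hle : ∀ i ∉ B, |y i| ≤ τ) {a : EuclideanSpace ℝ (Fin p)} (ha : a ∈ atoms p k) :
    inner ℝ y a ≤ τ / A * √(headTailSq k w B A) := by
  have hA := h.pos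
  have hlevel : ∀ i ∈ B, τ ≤ |y i| := fun i hi => by
    rw [hB i hi, abs_mul, abs_of_nonneg (div_nonneg hτ hA.le), div_mul_eq_mul_div, le_div_iff₀ hA]
    exact mul_le_mul_of_nonneg_left (h.le_of_mem i hi) hτ
  obtain ⟨F, hFk, hF⟩ := exists_inner_le_sqrt_of_mem_atoms ha y
  have hsum : ∑ i ∈ F, y i ^ 2 ≤ (τ / A) ^ 2 * headTailSq k w B A :=
    calc ∑ i ∈ F, y i ^ 2
        ≤ ∑ i ∈ B, y i ^ 2 + (#F - #B) * τ ^ 2 := sum_sq_le_sum_sq_add hτ hlevel hle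
      _ ≤ ∑ i ∈ B, y i ^ 2 + (k - #B) * τ ^ 2 := by gcongr
      _ = (τ / A) ^ 2 * headTailSq k w B A := by
          rw [sum_congr rfl fun i hi => by rw [hB i hi, mul_pow], ← mul_sum, headTailSq]
          field_simp
  calc inner ℝ y a ≤ √((τ / A) ^ 2 * headTailSq k w B A) := hF.trans (Real.sqrt_le_sqrt hsum)
    _ = τ / A * √(headTailSq k w B A) := by
        rw [Real.sqrt_mul (sq_nonneg _), Real.sqrt_sq (div_nonneg hτ hA.le)]

lemma mem_normalCone (h : IsHeadTailSplit k w B A) (hτ : 0 ≤ τ) {y : EuclideanSpace ℝ (Fin p)}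
    (hB : ∀ i ∈ B, y i = τ / A * w i) (hle : ∀ i ∉ B, |y i| ≤ τ)
    (hyw : ∀ i ∉ B, y i * w i = τ * |w i|) : y ∈ normalCone (kSupportNorm k) w := by
  have hA := h.pos
  have hM : 0 ≤ τ / A * √(headTailSq k w B A) := by positivity
  refine mem_normalCone_of_inner_le_mul hM
    (le_mul_gauge_convexHull (absorbent_nhds_zero h.convexHull_atoms_mem_nhds)
      (innerSL ℝ y).toLinearMap hM fun a ha => h.inner_le_of_mem_atoms hτ hB hle ha) ?_
  calc τ / A * √(headTailSq k w B A) * kSupportNorm k w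
      ≤ τ / A * √(headTailSq k w B A) * √(headTailSq k w B A) :=
        mul_le_mul_of_nonneg_left h.kSupportNorm_le hM
    _ = inner ℝ y w := by
        rw [h.inner_eq hB hyw, mul_assoc, Real.mul_self_sqrt h.headTailSq_pos.le]

end IsHeadTailSplit

/-- The `i`-th coordinate, as a function of the `i`-th coordinate `x` of the Gaussian vector, of an
element of the normal cone of the `k`-support norm at a vector `w` with head `B`, level `A` and
support in `C`. -/
noncomputable def normalField (w : EuclideanSpace ℝ (Fin p)) (B C : Finset (Fin p)) (A τ : ℝ)
    (i : Fin p) (x : ℝ) : ℝ :=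
  if i ∈ B then τ / A * w i else if i ∈ C then τ * SignType.sign (w i) else clip τ x

lemma measurable_normalField (w : EuclideanSpace ℝ (Fin p)) (B C : Finset (Fin p)) (A τ : ℝ)
    (i : Fin p) : Measurable (normalField w B C A τ i) := by
  unfold normalField
  split_ifs <;> fun_prop

lemma IsHeadTailSplit.normalField_mem_normalCone (h : IsHeadTailSplit k w B A) (hτ : 0 ≤ τ)
    (hC : ∀ i ∉ C, w i = 0) (x : Fin p → ℝ) :
    WithLp.toLp 2 (fun i => normalField w B C A τ i (x i)) ∈ normalCone (kSupportNorm k) w := by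
  refine h.mem_normalCone hτ (fun i hi => by simp [normalField, hi]) (fun i hi => ?_)
    fun i hi => ?_ <;> by_cases hiC : i ∈ C
  · simpa [normalField, hi, hiC, abs_mul, abs_of_nonneg hτ] using
      mul_le_of_le_one_right hτ (abs_coe_sign_le_one (w i))
  · simpa [normalField, hi, hiC] using abs_clip_le hτ (x i)
  · simp [normalField, hi, hiC, mul_assoc, sign_mul_self]
  · simp [hC i hiC]

/-- The bounds on the mean squared distances between a standard Gaussian variable and the values of
`normalField`. -/
noncomputable def normalFieldBound (w : EuclideanSpace ℝ (Fin p)) (B C : Finset (Fin p)) (A τ : ℝ)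
    (i : Fin p) : ℝ :=
  if i ∈ B then 1 + (τ / A * w i) ^ 2 else if i ∈ C then 1 + τ ^ 2 else 2 * thresholdConst τ

lemma normalFieldBound_nonneg (hτ : 0 ≤ τ) (i : Fin p) : 0 ≤ normalFieldBound w B C A τ i := by
  have := thresholdConst_nonneg hτ
  unfold normalFieldBound
  split_ifs <;> positivity

lemma lintegral_sub_normalField_sq_le {i : Fin p} (hτ : i ∉ C → 0 < τ) :
    ∫⁻ x, ENNReal.ofReal ((x - normalField w B C A τ i x) ^ 2) ∂gaussianReal 0 1 ≤
      ENNReal.ofReal (normalFieldBound w B C A τ i) := by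
  unfold normalField normalFieldBound
  split_ifs with hB hC
  · simp [lintegral_gaussianReal_sub_sq]
  · rw [lintegral_gaussianReal_sub_sq, NNReal.coe_one, zero_sub, neg_sq, mul_pow]
    gcongr
    exact mul_le_of_le_one_right (sq_nonneg τ)
      ((sq_le_one_iff_abs_le_one _).2 (abs_coe_sign_le_one (w i)))
  · exact lintegral_gaussianReal_softThreshold_sq_le (hτ hC)

lemma sum_normalFieldBound (hBC : B ⊆ C) :
    ∑ i, normalFieldBound w B C A τ i =
      #C + τ ^ 2 * ((∑ i ∈ B, w i ^ 2) / A ^ 2 + (#C - #B)) +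
        (p - #C : ℝ) * (2 * thresholdConst τ) := by
  have hhead : ∑ i ∈ B, normalFieldBound w B C A τ i =
      #B + τ ^ 2 * ((∑ i ∈ B, w i ^ 2) / A ^ 2) := by
    rw [sum_congr rfl fun i hi => by rw [normalFieldBound, if_pos hi, mul_pow, div_pow],
      sum_add_distrib, ← mul_sum, sum_const, nsmul_one]
    ring
  have htail : ∑ i ∈ C \ B, normalFieldBound w B C A τ i = (#C - #B : ℝ) * (1 + τ ^ 2) := by
    rw [sum_congr rfl fun i hi => by
        rw [normalFieldBound, if_neg (mem_sdiff.1 hi).2, if_pos (mem_sdiff.1 hi).1],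
      sum_const, nsmul_eq_mul, card_sdiff_of_subset hBC, Nat.cast_sub (card_le_card hBC)]
  have hoff : ∑ i ∈ Cᶜ, normalFieldBound w B C A τ i =
      (p - #C : ℝ) * (2 * thresholdConst τ) := by
    rw [sum_congr rfl fun i hi => by
        rw [normalFieldBound, if_neg fun hB => mem_compl.1 hi (hBC hB), if_neg (mem_compl.1 hi)],
      sum_const, nsmul_eq_mul, card_compl, Fintype.card_fin, Nat.cast_sub (card_finset_fin_le C)]
  rw [← sum_add_sum_compl C, ← sum_sdiff hBC, hhead, htail, hoff]
  ring

lemma one_sub_exp_mul_thresholdConst_le (hτ : 0 ≤ τ) :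
    (1 - Real.exp (-(τ ^ 2 / 2))) * thresholdConst τ ≤ Real.exp (-(τ ^ 2 / 2)) / 8 := by
  rcases hτ.eq_or_lt with rfl | hτ
  · simp [thresholdConst]
  set q := Real.exp (-(τ ^ 2 / 2)) with hq
  have hq0 : 0 < q := Real.exp_pos _
  have hq1 : 0 ≤ 1 - q := sub_nonneg.2 (Real.exp_le_one_iff.2 (by linarith [sq_nonneg τ]))
  have hqτ : 1 - q ≤ τ ^ 2 / 2 := by linarith [Real.add_one_le_exp (-(τ ^ 2 / 2))]
  have hexp : (7.29 : ℝ) ≤ Real.exp 1 ^ 2 := by nlinarith [Real.exp_one_gt_d9]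
  have hdenom : (1 - q) * 8 ≤ Real.exp 1 * τ * √(2 * Real.pi) := by
    refine (sq_le_sq₀ (by positivity) (by positivity)).1 ?_
    calc ((1 - q) * 8) ^ 2 = 64 * ((1 - q) * (1 - q)) := by ring
      _ ≤ 64 * (τ ^ 2 / 2 * 1) := by gcongr; linarith
      _ ≤ 7.29 * τ ^ 2 * (2 * 3) := by linarith [sq_nonneg τ]
      _ ≤ Real.exp 1 ^ 2 * τ ^ 2 * (2 * Real.pi) := by gcongr; exact Real.pi_gt_three.le
      _ = (Real.exp 1 * τ * √(2 * Real.pi)) ^ 2 := by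
          rw [mul_pow, mul_pow, Real.sq_sqrt (by positivity)]
  rw [thresholdConst, ← hq, ← mul_div_assoc, div_le_div_iff₀ (by positivity) (by norm_num)]
  linarith [mul_le_mul_of_nonneg_left hdenom hq0.le]

lemma sub_mul_thresholdConst_sqrt_log_le {s d : ℝ} (hs : 0 < s) (hsd : s ≤ d) :
    (d - s) * (2 * thresholdConst √(2 * Real.log (d / s))) ≤ s / 4 := by
  have hd : 0 < d := hs.trans_le hsd
  have hlog : 0 ≤ Real.log (d / s) := Real.log_nonneg ((one_le_div hs).2 hsd)
  have hexp : Real.exp (-(√(2 * Real.log (d / s)) ^ 2 / 2)) = s / d := by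
    rw [Real.sq_sqrt (by positivity), mul_div_cancel_left₀ _ two_ne_zero, Real.exp_neg,
      Real.exp_log (by positivity), inv_div]
  have hconst := one_sub_exp_mul_thresholdConst_le (Real.sqrt_nonneg (2 * Real.log (d / s)))
  rw [hexp] at hconst
  calc (d - s) * (2 * thresholdConst √(2 * Real.log (d / s)))
      = 2 * d * ((1 - s / d) * thresholdConst √(2 * Real.log (d / s))) := by field_simp
    _ ≤ 2 * d * (s / d / 8) := by gcongr
    _ = s / 4 := by field_simp; ring

theorem IsHeadTailSplit.statisticalDimension_le (h : IsHeadTailSplit k w B A) (hBC : B ⊆ C)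
    (hC : ∀ i ∉ C, w i = 0) :
    statisticalDimension w (kSupportNorm k) ≤ ENNReal.ofReal (5 / 4 * #C +
      2 * ((∑ i ∈ B, w i ^ 2) / A ^ 2 + (#C - #B : ℝ)) * Real.log (p / #C)) := by
  have hC0 : (0 : ℝ) < #C := by
    exact_mod_cast (Nat.zero_lt_of_lt h.card_lt).trans_le (h.le_card hBC hC)
  have hCp : (#C : ℝ) ≤ p := by exact_mod_cast card_finset_fin_le C
  have hlog : 0 ≤ Real.log (p / #C) := Real.log_nonneg ((one_le_div hC0).2 hCp)
  set τ := √(2 * Real.log (p / #C))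
  have hτ0 : 0 ≤ τ := Real.sqrt_nonneg _
  have hτ2 : τ ^ 2 = 2 * Real.log (p / #C) := Real.sq_sqrt (by positivity)
  have hτpos (i : Fin p) (hi : i ∉ C) : 0 < τ := by
    have hlt : (#C : ℝ) < p := by
      exact_mod_cast (card_lt_univ_of_notMem hi).trans_eq (Fintype.card_fin p)
    exact Real.sqrt_pos.2 (mul_pos two_pos (Real.log_pos ((one_lt_div hC0).2 hlt)))
  calc statisticalDimension w (kSupportNorm k)
      ≤ ∑ i, ∫⁻ x, ENNReal.ofReal ((x - normalField w B C A τ i x) ^ 2) ∂gaussianReal 0 1 :=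
        statisticalDimension_le_sum_lintegral (measurable_normalField w B C A τ) fun g =>
          h.normalField_mem_normalCone hτ0 hC g
    _ ≤ ∑ i, ENNReal.ofReal (normalFieldBound w B C A τ i) :=
        sum_le_sum fun i _ => lintegral_sub_normalField_sq_le (hτpos i)
    _ = ENNReal.ofReal (∑ i, normalFieldBound w B C A τ i) :=
        (ENNReal.ofReal_sum_of_nonneg fun i _ => normalFieldBound_nonneg hτ0 i).symm
    _ ≤ ENNReal.ofReal (5 / 4 * #C +
          2 * ((∑ i ∈ B, w i ^ 2) / A ^ 2 + (#C - #B : ℝ)) * Real.log (p / #C)) := by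
        refine ENNReal.ofReal_le_ofReal ?_
        rw [sum_normalFieldBound hBC, hτ2]
        linarith [sub_mul_thresholdConst_sqrt_log_le hC0 hCp]

end HeadTail

section Sorting

variable {p : ℕ} {w : EuclideanSpace ℝ (Fin p)} {n : ℕ} {j : Fin p}

/-- The position, between `1` and `p`, of the index `j` in the sorted vector. -/
noncomputable def rank (w : EuclideanSpace ℝ (Fin p)) (j : Fin p) : ℕ :=
  (Tuple.sort fun j => -|w j|).symm j + 1

lemma rank_mem_Icc (w : EuclideanSpace ℝ (Fin p)) (j : Fin p) : rank w j ∈ Icc 1 p :=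
  mem_Icc.2 ⟨Nat.le_add_left _ _, ((Tuple.sort fun j => -|w j|).symm j).isLt⟩

lemma rank_injective (w : EuclideanSpace ℝ (Fin p)) : Function.Injective (rank w) := by
  intro i j h
  simpa [rank, Fin.val_inj] using h

lemma exists_rank_eq (w : EuclideanSpace ℝ (Fin p)) (hn : n ∈ Icc 1 p) : ∃ j, rank w j = n := by
  obtain ⟨h1, hp⟩ := mem_Icc.1 hn
  exact ⟨Tuple.sort (fun j => -|w j|) ⟨n - 1, by omega⟩, by
    rw [rank, Equiv.symm_apply_apply, Nat.sub_add_cancel h1]⟩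

lemma sortedEntry_rank (w : EuclideanSpace ℝ (Fin p)) (j : Fin p) :
    sortedEntry w (rank w j) = w j := by
  rw [sortedEntry, dif_pos (mem_Icc.1 (rank_mem_Icc w j))]
  exact congrArg w ((Tuple.sort fun j => -|w j|).apply_symm_apply j)

lemma sortedEntry_of_dim_lt (w : EuclideanSpace ℝ (Fin p)) (hn : p < n) : sortedEntry w n = 0 :=
  dif_neg fun h => hn.not_ge h.2

lemma abs_sortedEntry_anti (w : EuclideanSpace ℝ (Fin p)) {m : ℕ} (hm : 1 ≤ m) (hmn : m ≤ n) :
    |sortedEntry w n| ≤ |sortedEntry w m| := by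
  rcases le_or_gt n p with hn | hn
  · rw [sortedEntry, sortedEntry, dif_pos ⟨hm.trans hmn, hn⟩, dif_pos ⟨hm, hmn.trans hn⟩]
    have hsort := Tuple.monotone_sort (fun j => -|w j|) (a := ⟨m - 1, by omega⟩)
      (b := ⟨n - 1, by omega⟩) (Fin.mk_le_mk.2 (by omega))
    simpa using hsort
  · simp [sortedEntry_of_dim_lt w hn]

lemma sum_sortedEntry {M : Type*} [AddCommMonoid M] (w : EuclideanSpace ℝ (Fin p)) {S : Finset ℕ}
    (hS : S ⊆ Icc 1 p) (f : ℝ → M) :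
    ∑ i ∈ S, f (sortedEntry w i) = ∑ j with rank w j ∈ S, f (w j) := by
  refine (sum_nbij (rank w) (fun j hj => (mem_filter.1 hj).2) (rank_injective w).injOn
    (fun n hn => ?_) fun j _ => by rw [sortedEntry_rank]).symm
  obtain ⟨j, rfl⟩ := exists_rank_eq w (hS hn)
  exact ⟨j, by simpa using hn, rfl⟩

lemma sum_sq_abs_sortedEntry_le (w : EuclideanSpace ℝ (Fin p)) {S : Finset ℕ} (hS : S ⊆ Icc 1 p) :
    ∑ i ∈ S, |sortedEntry w i| ^ 2 ≤ ‖w‖ ^ 2 := by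
  rw [sum_sortedEntry w hS fun x => |x| ^ 2, EuclideanSpace.norm_sq_eq]
  exact sum_le_univ_sum_of_nonneg fun i => sq_nonneg _

/-- The indices of the `n` entries of `w` of largest absolute value. -/
noncomputable def largest (w : EuclideanSpace ℝ (Fin p)) (n : ℕ) : Finset (Fin p) :=
  {j | rank w j ∈ Icc 1 n}

lemma mem_largest : j ∈ largest w n ↔ rank w j ≤ n := by
  simp [largest, (mem_Icc.1 (rank_mem_Icc w j)).1]

lemma largest_mono (w : EuclideanSpace ℝ (Fin p)) : Monotone (largest w) :=
  fun _ _ hmn _ hj => mem_largest.2 ((mem_largest.1 hj).trans hmn)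

lemma card_largest (w : EuclideanSpace ℝ (Fin p)) (hn : n ≤ p) : #(largest w n) = n := by
  rw [largest, card_eq_sum_ones, ← sum_sortedEntry w (Icc_subset_Icc_right hn) fun _ => 1,
    ← card_eq_sum_ones, Nat.card_Icc, Nat.add_sub_cancel]

lemma sum_compl_largest (w : EuclideanSpace ℝ (Fin p)) (n : ℕ) (f : ℝ → ℝ) :
    ∑ j ∈ (largest w n)ᶜ, f (w j) = ∑ i ∈ Icc (n + 1) p, f (sortedEntry w i) := by
  rw [sum_sortedEntry w (Icc_subset_Icc_left (Nat.le_add_left 1 n))]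
  refine sum_congr ?_ fun _ _ => rfl
  ext j
  simp [mem_largest, (mem_Icc.1 (rank_mem_Icc w j)).2]

lemma abs_sortedEntry_le_of_mem_largest (hj : j ∈ largest w n) : |sortedEntry w n| ≤ |w j| :=
  sortedEntry_rank w j ▸
    abs_sortedEntry_anti w (mem_Icc.1 (rank_mem_Icc w j)).1 (mem_largest.1 hj)

lemma abs_le_of_notMem_largest (hj : j ∉ largest w n) : |w j| ≤ |sortedEntry w (n + 1)| :=
  sortedEntry_rank w j ▸
    abs_sortedEntry_anti w (Nat.le_add_left 1 n) (not_le.1 fun h => hj (mem_largest.2 h))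

lemma sortedEntry_ne_zero (hn : n + 1 ≤ nnz w) : sortedEntry w (n + 1) ≠ 0 := by
  intro h0
  have hnnz : nnz w ≤ #(largest w n) := nnz_le_card fun j hj =>
    abs_nonpos_iff.1 (by simpa [h0] using abs_le_of_notMem_largest hj)
  rw [card_largest w ((Nat.le_of_succ_le hn).trans (nnz_le w))] at hnnz
  omega

lemma sortedEntry_eq_zero (hn : nnz w < n) : sortedEntry w n = 0 := by
  rcases le_or_gt n p with hp | hp
  · by_contra h0
    have hnnz : #(largest w n) ≤ nnz w := by
      rw [nnz_eq_card_filter]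
      refine card_le_card fun j hj => mem_filter.2 ⟨mem_univ j, fun hj0 => h0 ?_⟩
      exact abs_nonpos_iff.1 (by simpa [hj0] using abs_sortedEntry_le_of_mem_largest hj)
    rw [card_largest w hp] at hnnz
    omega
  · exact sortedEntry_of_dim_lt w hp

lemma eq_zero_of_notMem_largest (hn : nnz w ≤ n) (hj : j ∉ largest w n) : w j = 0 :=
  abs_nonpos_iff.1 <| by
    simpa [sortedEntry_eq_zero (Nat.lt_succ_of_le hn)] using abs_le_of_notMem_largest hj

end Sorting

section Breakpoint

variable {k p r : ℕ} {c : ℕ → ℝ}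

lemma existsUnique_last_of_downward_closed {P : ℕ → Prop} (hk : 0 < k) (hP₀ : P 0)
    (hP : ∀ r, r + 1 < k → P (r + 1) → P r) :
    ∃! r, r < k ∧ (r + 1 < k → ¬ P (r + 1)) ∧ P r := by
  classical
  have hanti {r s : ℕ} (hrs : r ≤ s) (hs : s < k) (hPs : P s) : P r := by
    induction s, hrs using Nat.le_induction with
    | base => exact hPs
    | succ n _ ih => exact ih (Nat.lt_of_succ_lt hs) (hP n hs hPs)
  refine existsUnique_of_exists_of_unique
    ⟨Nat.findGreatest P (k - 1), ?_, fun h => ?_, Nat.findGreatest_spec (Nat.zero_le _) hP₀⟩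
    fun r s ⟨hr, hr', hPr⟩ ⟨hs, hs', hPs⟩ => ?_
  · exact (Nat.findGreatest_le _).trans_lt (Nat.sub_one_lt_of_lt hk)
  · exact Nat.findGreatest_is_greatest (Nat.lt_succ_self _) (Nat.le_sub_one_of_lt h)
  · rcases lt_trichotomy r s with h | h | h
    · exact absurd (hanti h hs hPs) (hr' (by omega))
    · exact h
    · exact absurd (hanti h hr hPr) (hs' (by omega))

/-- The common value of `r + 1` equal entries with the same sum as `c` over `{k - r, …, p}`. -/
noncomputable def tailAverage (c : ℕ → ℝ) (p k r : ℕ) : ℝ :=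
  1 / ((r : ℝ) + 1) * ∑ i ∈ Icc (k - r) p, c i

lemma add_one_mul_tailAverage (c : ℕ → ℝ) (p k r : ℕ) :
    ((r : ℝ) + 1) * tailAverage c p k r = ∑ i ∈ Icc (k - r) p, c i := by
  rw [tailAverage]
  field_simp

lemma add_two_mul_tailAverage_succ (c : ℕ → ℝ) (hkp : k ≤ p) (hr : r + 1 < k) :
    ((r : ℝ) + 2) * tailAverage c p k (r + 1) =
      c (k - (r + 1)) + ((r : ℝ) + 1) * tailAverage c p k r := by
  have hsplit := add_sum_Ioc_eq_sum_Icc (f := c) (by omega : k - (r + 1) ≤ p)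
  rw [← Icc_add_one_left_eq_Ioc, (by omega : k - (r + 1) + 1 = k - r)] at hsplit
  rw [add_one_mul_tailAverage, hsplit, ← add_one_mul_tailAverage]
  push_cast
  ring

lemma le_tailAverage_succ_iff (hkp : k ≤ p) (hr : r + 1 < k) :
    c (k - (r + 1)) ≤ tailAverage c p k (r + 1) ↔ c (k - (r + 1)) ≤ tailAverage c p k r := by
  have hstep := add_two_mul_tailAverage_succ c hkp hr
  have hr₁ : (0 : ℝ) < r + 1 := by positivity
  have hr₂ : (0 : ℝ) < r + 2 := by positivity
  rw [← mul_le_mul_iff_right₀ hr₂, hstep,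
    ← mul_le_mul_iff_right₀ hr₁ (c := tailAverage c p k r)]
  constructor <;> intro h <;> linarith

lemma existsUnique_breakpoint (hc0 : ∀ i, 0 ≤ c i) (hc : ∀ i, 1 ≤ i → c (i + 1) ≤ c i)
    (hk : 0 < k) (hkp : k ≤ p) :
    ∃! r, r < k ∧ (k - r - 1 = 0 ∨ tailAverage c p k r < c (k - r - 1)) ∧
      c (k - r) ≤ tailAverage c p k r := by
  have hP₀ : c (k - 0) ≤ tailAverage c p k 0 := by
    simpa [tailAverage] using single_le_sum (fun i _ => hc0 i) (left_mem_Icc.2 hkp)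
  have hP (r : ℕ) (hr : r + 1 < k) (h : c (k - (r + 1)) ≤ tailAverage c p k (r + 1)) :
      c (k - r) ≤ tailAverage c p k r := by
    have hanti := hc (k - (r + 1)) (by omega)
    rw [(by omega : k - (r + 1) + 1 = k - r)] at hanti
    exact hanti.trans ((le_tailAverage_succ_iff hkp hr).1 h)
  refine (existsUnique_congr fun r => ?_).1
    (existsUnique_last_of_downward_closed (P := fun r => c (k - r) ≤ tailAverage c p k r) hk hP₀ hP)
  refine and_congr_right fun hrk => and_congr_left' ?_
  rcases (Nat.succ_le_of_lt hrk).lt_or_eq with hr | hr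
  · rw [le_tailAverage_succ_iff hkp hr, not_le, Nat.sub_sub]
    simp [hr, (Nat.sub_pos_of_lt hr).ne']
  · simp [← hr]

end Breakpoint

section Index

variable {p k r s : ℕ} {w : EuclideanSpace ℝ (Fin p)}

theorem existsUnique_isIndex (hk : 1 ≤ k) (hkp : k ≤ p) (w : EuclideanSpace ℝ (Fin p)) :
    ∃! r : ℕ, IsIndex k w r :=
  existsUnique_breakpoint (c := fun i => |sortedEntry w i|) (fun _ => abs_nonneg _)
    (fun i hi => abs_sortedEntry_anti w hi i.le_succ) hk hkp

lemma IsIndex.isHeadTailSplit (hr : IsIndex k w r) (hkw : k ≤ nnz w) :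
    IsHeadTailSplit k w (largest w (k - r - 1))
      (tailAverage (fun i => |sortedEntry w i|) p k r) := by
  obtain ⟨hrk, hhead, htail⟩ := hr
  have hkp : k ≤ p := hkw.trans (nnz_le w)
  have hsucc : k - r - 1 + 1 = k - r := by omega
  have hcard : #(largest w (k - r - 1)) = k - r - 1 := card_largest w (by omega)
  refine ⟨by omega, ?_, fun j hj => ?_, fun j hj => ?_, ?_⟩
  · refine (abs_pos.2 ?_).trans_le htail
    exact hsucc ▸ sortedEntry_ne_zero (by omega)
  · have hrank := (mem_Icc.1 (rank_mem_Icc w j)).1.trans (mem_largest.1 hj)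
    exact (hhead.resolve_left (by omega)).le.trans (abs_sortedEntry_le_of_mem_largest hj)
  · refine (abs_le_of_notMem_largest hj).trans ?_
    rwa [hsucc]
  · have hcast : (k : ℝ) - (k - r - 1 : ℕ) = r + 1 := by
      rw [← Nat.cast_sub (by omega), (by omega : k - (k - r - 1) = r + 1), Nat.cast_add_one]
    rw [sum_compl_largest w _ fun x => |x|, hsucc, hcard, hcast, add_one_mul_tailAverage]

theorem IsIndex.statisticalDimension_le (hr : IsIndex k w r) (hkw : k ≤ nnz w)
    (hws : nnz w ≤ s) (hsp : s ≤ p) :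
    statisticalDimension w (kSupportNorm k) ≤ ENNReal.ofReal (5 / 4 * (s : ℝ) +
      2 * (((r : ℝ) + 1) ^ 2 * (∑ i ∈ Icc 1 (k - r - 1), |sortedEntry w i| ^ 2) /
        (∑ i ∈ Icc (k - r) s, |sortedEntry w i|) ^ 2 + (#(Icc (k - r) s) : ℝ)) *
        Real.log ((p : ℝ) / (s : ℝ))) := by
  have hrk := hr.1
  have htail : ∑ i ∈ Icc (k - r) s, |sortedEntry w i| =
      ((r : ℝ) + 1) * tailAverage (fun i => |sortedEntry w i|) p k r := by
    rw [add_one_mul_tailAverage]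
    refine sum_subset (Icc_subset_Icc_right hsp) fun i hi hi' => ?_
    rw [sortedEntry_eq_zero (by simp only [mem_Icc] at hi hi'; omega), abs_zero]
  have hhead : ∑ i ∈ Icc 1 (k - r - 1), |sortedEntry w i| ^ 2 =
      ∑ j ∈ largest w (k - r - 1), w j ^ 2 := by
    rw [sum_sortedEntry w (Icc_subset_Icc_right (by omega)) fun x => |x| ^ 2]
    simp only [sq_abs, largest]
  have hcard : (#(Icc (k - r) s) : ℝ) = s - (k - r - 1 : ℕ) := by
    rw [Nat.card_Icc, ← Nat.cast_sub (by omega)]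
    congr 1
    omega
  have hbound := (hr.isHeadTailSplit hkw).statisticalDimension_le
    (largest_mono w (by omega : k - r - 1 ≤ s)) fun j hj => eq_zero_of_notMem_largest hws hj
  rw [card_largest w hsp, card_largest w (by omega)] at hbound
  rwa [htail, hhead, hcard, mul_pow, mul_div_mul_left _ _ (by positivity)]

end Index

section Strength

variable {p k r : ℕ} {a : EuclideanSpace ℝ (Fin p)}

lemma exists_strength_eq (ha : a ≠ 0) (k : ℕ) :
    ∃ i, a i ≠ 0 ∧ strength k a = k * |a i| ^ 2 ∧ ∀ j, a j ≠ 0 → |a i| ≤ |a j| := by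
  have hsupp : {i : Fin p | a i ≠ 0}.Nonempty := by
    by_contra! hempty
    exact ha (by ext i; simpa using Set.eq_empty_iff_forall_notMem.1 hempty i)
  have hfin : ((fun i => a i ^ 2) '' {i : Fin p | a i ≠ 0}).Finite := Set.toFinite _
  obtain ⟨i, hi, hmin⟩ := (hsupp.image fun i => a i ^ 2).csInf_mem hfin
  refine ⟨i, hi, by rw [strength, ← hmin, sq_abs], fun j hj => sq_le_sq.1 ?_⟩
  exact hmin.le.trans (csInf_le hfin.bddBelow ⟨j, hj, rfl⟩)

lemma card_sq_mul_div_add_card_le {ι : Type*} {J : Finset ι} (hJ : J.Nonempty) {u : ι → ℝ}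
    {δ Q : ℝ} (hδ : 0 < δ) (hu : ∀ i ∈ J, δ ≤ u i) (hQ : 0 ≤ Q)
    (hsum : Q + ∑ i ∈ J, u i ^ 2 ≤ 1) :
    (#J : ℝ) ^ 2 * Q / (∑ i ∈ J, u i) ^ 2 + #J ≤ 1 / δ ^ 2 := by
  have : (0 : ℝ) < #J := by exact_mod_cast hJ.card_pos
  have hsum₁ : #J * δ ≤ ∑ i ∈ J, u i := by
    simpa only [nsmul_eq_mul] using card_nsmul_le_sum J u δ hu
  have hsum₂ : #J * δ ^ 2 ≤ ∑ i ∈ J, u i ^ 2 := by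
    simpa only [nsmul_eq_mul] using card_nsmul_le_sum J (fun i => u i ^ 2) (δ ^ 2)
      fun i hi => pow_le_pow_left₀ hδ.le (hu i hi) 2
  calc (#J : ℝ) ^ 2 * Q / (∑ i ∈ J, u i) ^ 2 + #J
      ≤ (#J : ℝ) ^ 2 * Q / (#J * δ) ^ 2 + #J := by gcongr
    _ = (Q + #J * δ ^ 2) / δ ^ 2 := by field_simp
    _ ≤ 1 / δ ^ 2 := by gcongr; linarith

lemma coefficient_le_div_strength (hrk : r < k) (ha : ‖a‖ = 1) (hak : nnz a = k) :
    ((r : ℝ) + 1) ^ 2 * (∑ i ∈ Icc 1 (k - r - 1), |sortedEntry a i| ^ 2) /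
        (∑ i ∈ Icc (k - r) k, |sortedEntry a i|) ^ 2 + (#(Icc (k - r) k) : ℝ) ≤
      k / strength k a := by
  have hkp : k ≤ p := hak ▸ nnz_le a
  have hk0 : (k : ℝ) ≠ 0 := by exact_mod_cast (Nat.zero_lt_of_lt hrk).ne'
  have ha0 : a ≠ 0 := norm_ne_zero_iff.1 (ha ▸ one_ne_zero)
  obtain ⟨i₀, hi₀, hstrength, hmin⟩ := exists_strength_eq ha0 k
  have hentry : ∀ i ∈ Icc (k - r) k, |a i₀| ≤ |sortedEntry a i| := fun i hi => by
    obtain ⟨hi₁, hi₂⟩ := mem_Icc.1 hi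
    obtain ⟨j, rfl⟩ := exists_rank_eq a (mem_Icc.2 ⟨by omega, hi₂.trans hkp⟩)
    have hj : sortedEntry a (rank a j - 1 + 1) ≠ 0 := sortedEntry_ne_zero (by omega)
    rw [Nat.sub_add_cancel (by omega)] at hj
    rw [sortedEntry_rank] at hj ⊢
    exact hmin j hj
  have hdisj : Disjoint (Icc 1 (k - r - 1)) (Icc (k - r) k) :=
    disjoint_left.2 fun i => by simp only [mem_Icc]; omega
  have hsum : ∑ i ∈ Icc 1 (k - r - 1), |sortedEntry a i| ^ 2 +
      ∑ i ∈ Icc (k - r) k, |sortedEntry a i| ^ 2 ≤ 1 := by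
    rw [← sum_union hdisj]
    refine (sum_sq_abs_sortedEntry_le a fun i => ?_).trans (by simp [ha])
    simp only [mem_union, mem_Icc]
    omega
  have hcard : ((r : ℝ) + 1) = #(Icc (k - r) k) := by
    rw [Nat.card_Icc, (by omega : k + 1 - (k - r) = r + 1), Nat.cast_add_one]
  rw [hcard, hstrength, div_mul_cancel_left₀ hk0, ← one_div]
  exact card_sq_mul_div_add_card_le (nonempty_Icc.2 (Nat.sub_le k r)) (abs_pos.2 hi₀) hentry
    (sum_nonneg fun _ _ => sq_nonneg _) hsum

theorem statisticalDimension_le_of_mem_atoms (hk : 1 ≤ k) (ha : a ∈ atoms p k)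
    (hak : nnz a = k) :
    statisticalDimension a (kSupportNorm k) ≤ ENNReal.ofReal (5 / 4 * (k : ℝ) +
      2 * (k : ℝ) / strength k a * Real.log ((p : ℝ) / (k : ℝ))) := by
  have hkp : k ≤ p := hak ▸ nnz_le a
  obtain ⟨r, hr, -⟩ := existsUnique_isIndex hk hkp a
  have hlog : 0 ≤ Real.log ((p : ℝ) / k) :=
    Real.log_nonneg ((one_le_div (by exact_mod_cast hk)).2 (by exact_mod_cast hkp))
  refine (hr.statisticalDimension_le hak.ge hak.le hkp).trans (ENNReal.ofReal_le_ofReal ?_)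
  rw [mul_div_assoc 2 (k : ℝ)]
  gcongr
  exact coefficient_le_div_strength hr.1 ha.2 hak

end Strength

end KSupport

theorem mainTheorem11 (p k : ℕ) (hk : 1 ≤ k) :
    (∀ (s : ℕ) (w : EuclideanSpace ℝ (Fin p)),
      k ≤ KSupport.nnz w → KSupport.nnz w ≤ s → s ≤ p →
      (∃! r : ℕ, KSupport.IsIndex k w r) ∧
      ∀ r : ℕ, KSupport.IsIndex k w r →
        KSupport.statisticalDimension w (KSupport.kSupportNorm k) ≤
          ENNReal.ofReal
            (5 / 4 * (s : ℝ) +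
              2 * (((r : ℝ) + 1) ^ 2 *
                    (∑ i ∈ Finset.Icc 1 (k - r - 1), |KSupport.sortedEntry w i| ^ 2) /
                    (∑ i ∈ Finset.Icc (k - r) s, |KSupport.sortedEntry w i|) ^ 2 +
                  ((Finset.Icc (k - r) s).card : ℝ)) *
                Real.log ((p : ℝ) / (s : ℝ)))) ∧
    (∀ a : EuclideanSpace ℝ (Fin p), a ∈ KSupport.atoms p k → KSupport.nnz a = k →
      KSupport.statisticalDimension a (KSupport.kSupportNorm k) ≤
        ENNReal.ofReal
          (5 / 4 * (k : ℝ) +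
            2 * (k : ℝ) / KSupport.strength k a * Real.log ((p : ℝ) / (k : ℝ)))) := by
  refine ⟨fun s w hkw hws hsp => ⟨?_, fun r hr => hr.statisticalDimension_le hkw hws hsp⟩,
    fun a ha hak => KSupport.statisticalDimension_le_of_mem_atoms hk ha hak⟩
  exact KSupport.existsUnique_isIndex hk (hkw.trans (KSupport.nnz_le w)) w
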